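/- **Agents and network.** Let $(A,B,C)$ with $A\in\mathbb R^{n\times n}$, $B\in\mathbb R^{n\times m}$, $C\in\mathbb R^{m\times n}$ be a minimal (controllable and observable) and passive linear system, and let $K_m$ and $K_M$ be the minimum and the maximum, in the Loewner order, of the set of symmetric positive definite $K$ with $$A^\top K+KA\le 0,\qquad C=B^\top K .$$ Let $L\in\mathbb R^{N\times N}$ be the Laplacian matrix of a connected undirected weighted graph with $N$ nodes and nonnegative weights, let $F\in\mathbb R^{N\times p}$, $H\in\mathbb R^{q\times N}$, and let $\mathbf 1_N$ be the all-ones vector. The network system is $$\mathbf\Sigma:\quad \dot x=(I_N\otimes A-L\otimes BC)x+(F\otimes B)u,\qquad y=(H\otimes C)x .$$ Let $L=T\,\mathrm{diag}(\Lambda,0)\,T^\top$ with $T=[T_1\ \ \mathbf 1_N/\sqrt N]$ orthogonal and $\Lambda=\mathrm{diag}(\lambda_1,\dots,\lambda_{N-1})$, $\lambda_1\ge\dots\ge\lambda_{N-1}>0$. Put $\bar F=T_1^\top F$, $\bar H=HT_1$. The stable part of $\mathbf\Sigma$ is $$\mathbf\Sigma_s:\quad \dot z=(I_{N-1}\otimes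 A-\Lambda\otimes BC)z+(\bar F\otimes B)u,\qquad y=(\bar H\otimes C)z .$$ **Balancing.** Let $X,Y\in\mathbb R^{(N-1)\times(N-1)}$ be symmetric positive definite with $$-\Lambda X-X\Lambda+\bar F\bar F^\top=0,\qquad -\Lambda Y-Y\Lambda+\bar H^\top\bar H\le 0,$$ and with $Y$ block diagonal with one block for each distinct eigenvalue, that is, $Y_{ij}=0$ whenever $\lambda_i\ne\lambda_j$. Let $T_{\mathcal G}$ and $T_{\mathcal D}$ be nonsingular with $$T_{\mathcal G}XT_{\mathcal G}^\top=T_{\mathcal G}^{-\top}YT_{\mathcal G}^{-1}=\mathrm{diag}(\sigma_1,\dots,\sigma_{N-1}),\qquad T_{\mathcal D}K_M^{-1}T_{\mathcal D}^\top=T_{\mathcal D}^{-\top}K_mT_{\mathcal D}^{-1}=\mathrm{diag}(\tau_1,\dots,\tau_n),$$ where $\sigma_1\ge\dots\ge\sigma_{N-1}$ and $\tau_1\ge\dots\ge\tau_n$. **Reduction.** Let $1\le k\le N$ and $r\le n$. Let $(\hat\Lambda_1,\hat F_1,\hat H_1)$ be the truncation of $(T_{\mathcal G}\Lambda T_{\mathcal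 G}^{-1},\,T_{\mathcal G}\bar F,\,\bar HT_{\mathcal G}^{-1})$ to the first $k-1$ states, and $(\hat A,\hat B,\hat C)$ the truncation of $(T_{\mathcal D}AT_{\mathcal D}^{-1},\,T_{\mathcal D}B,\,CT_{\mathcal D}^{-1})$ to the first $r$ states. The reduced stable part is $$\hat{\mathbf\Sigma}_s:\quad \dot z=(I_{k-1}\otimes\hat A-\hat\Lambda_1\otimes\hat B\hat C)z+(\hat F_1\otimes\hat B)u,\qquad y=(\hat H_1\otimes\hat C)z .$$ Put $$\mathcal N=\begin{bmatrix}\hat\Lambda_1&0\\0&0\end{bmatrix},\qquad \mathcal F=\begin{bmatrix}\hat F_1\\ \tfrac1{\sqrt N}\mathbf 1_N^\top F\end{bmatrix},\qquad \mathcal H=\begin{bmatrix}\hat H_1&\tfrac1{\sqrt N}H\mathbf 1_N\end{bmatrix},$$ let $\mathcal T_n$ be any nonsingular matrix for which $\hat L=\mathcal T_n^{-1}\mathcal N\mathcal T_n$ is the Laplacian matrix of a connected undirected weighted graph with $k$ nodes, and put $\hat F=\mathcal T_n^{-1}\mathcal F$, $\hat H=\mathcal H\mathcal T_n$. The reduced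 network model is $$\hat{\mathbf\Sigma}:\quad \dot{\hat x}=(I_k\otimes\hat A-\hat L\otimes\hat B\hat C)\hat x+(\hat F\otimes\hat B)u,\qquad \hat y=(\hat H\otimes\hat C)\hat x .$$ **Claim.** If $H\mathbf 1_N=0$ or $\mathbf 1_N^\top F=0$, then $$\|\mathbf\Sigma-\hat{\mathbf\Sigma}\|_{\mathcal H_\infty}=\|\mathbf\Sigma_s-\hat{\mathbf\Sigma}_s\|_{\mathcal H_\infty}\le\gamma,\qquad \gamma=2\sum_{i=k}^{N-1}\sum_{j=1}^{n}\sigma_i\tau_j+2\sum_{i=1}^{k-1}\sum_{j=r+1}^{n}\sigma_i\tau_j .$$ Here $\|\cdot\|_{\mathcal H_\infty}$ of a difference of systems is the supremum over $\operatorname{Re}s>0$ of the spectral norm of the difference of their transfer functions. -/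

import Mathlib

open Matrix
open scoped Kronecker ENNReal

namespace NetworkBT

/-! ### Linear systems, transfer functions, the `H∞` norm -/

/-- The linear time-invariant system `ẋ = A x + B u`, `y = C x`, with state, input and output
coordinates indexed by `ι`, `υ` and `ο`. -/
structure LTI (ι υ ο : Type) where
  A : Matrix ι ι ℝ
  B : Matrix ι υ ℝ
  C : Matrix ο ι ℝ

/-- The transfer function `s ↦ C (s I - A)⁻¹ B`. -/
noncomputable def LTI.transfer {ι υ ο : Type} [Fintype ι] [DecidableEq ι]
    (S : LTI ι υ ο) (s : ℂ) : Matrix ο υ ℂ :=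
  S.C.map Complex.ofReal * (s • (1 : Matrix ι ι ℂ) - S.A.map Complex.ofReal)⁻¹ *
    S.B.map Complex.ofReal

open scoped Matrix.Norms.L2Operator in
/-- The `H∞` norm: the supremum over the open right half-plane of the largest singular value
(spectral norm) of `G s`. It is `∞` if `G` is unbounded there, so in particular if a rational `G`
has a pole there. -/
noncomputable def hInfNorm {υ ο : Type} [Fintype υ] [Fintype ο] [DecidableEq υ]
    (G : ℂ → Matrix ο υ ℂ) : ℝ≥0∞ :=
  ⨆ (s : ℂ) (_ : 0 < s.re), ENNReal.ofReal ‖G s‖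

/-- `‖S₁ - S₂‖_{H∞}`: the `H∞` norm of the difference of the transfer functions. -/
noncomputable def hInfDist {ι κ υ ο : Type} [Fintype ι] [DecidableEq ι] [Fintype κ]
    [DecidableEq κ] [Fintype υ] [Fintype ο] [DecidableEq υ]
    (S₁ : LTI ι υ ο) (S₂ : LTI κ υ ο) : ℝ≥0∞ :=
  hInfNorm (fun s => S₁.transfer s - S₂.transfer s)

/-- Minimality of a realization: it is controllable (the columns of `B, AB, A²B, …` span the
state space) and observable (the kernels of `C, CA, CA², …` have trivial intersection). -/
def LTI.IsMinimal {ι υ ο : Type} [Fintype ι] [DecidableEq ι] [Fintype υ]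
    (S : LTI ι υ ο) : Prop :=
  (⨆ i : ℕ, LinearMap.range (S.A ^ i * S.B).mulVecLin) = ⊤ ∧
  (⨅ i : ℕ, LinearMap.ker (S.C * S.A ^ i).mulVecLin) = ⊥

/-- Passivity: there is a nonnegative storage function whose increase along any trajectory is at
most the supplied energy `∫ uᵀ y`. -/
def LTI.IsPassive {ι υ : Type} [Fintype ι] [Fintype υ] (S : LTI ι υ υ) : Prop :=
  ∃ V : (ι → ℝ) → ℝ, (∀ x, 0 ≤ V x) ∧
    ∀ (u : ℝ → υ → ℝ) (x : ℝ → ι → ℝ), Continuous u →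
      (∀ t, HasDerivAt x (S.A *ᵥ x t + S.B *ᵥ u t) t) →
      ∀ t₀ t₁ : ℝ, t₀ ≤ t₁ →
        V (x t₁) ≤ V (x t₀) + ∫ t in t₀..t₁, u t ⬝ᵥ (S.C *ᵥ x t)

/-- `K` is a symmetric positive definite solution of `Aᵀ K + K A ≤ 0`, `C = Bᵀ K`. -/
def LTI.IsKYPSolution {ι υ : Type} [Fintype ι] (S : LTI ι υ υ)
    (K : Matrix ι ι ℝ) : Prop :=
  K.PosDef ∧ (-(S.Aᵀ * K + K * S.A)).PosSemidef ∧ S.C = S.Bᵀ * K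

/-- `K` is the minimum solution, in the Loewner order. -/
def LTI.IsMinKYPSolution {ι υ : Type} [Fintype ι] (S : LTI ι υ υ)
    (K : Matrix ι ι ℝ) : Prop :=
  S.IsKYPSolution K ∧ ∀ K', S.IsKYPSolution K' → (K' - K).PosSemidef

/-- `K` is the maximum solution, in the Loewner order. -/
def LTI.IsMaxKYPSolution {ι υ : Type} [Fintype ι] (S : LTI ι υ υ)
    (K : Matrix ι ι ℝ) : Prop :=
  S.IsKYPSolution K ∧ ∀ K', S.IsKYPSolution K' → (K - K').PosSemidef

/-! ### Weighted graphs and networks -/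

/-- Edge weights of an undirected weighted graph (diagonal weights play no role). -/
def IsUndirectedWeight {V : Type} (w : V → V → ℝ) : Prop :=
  (∀ i j, w i j = w j i) ∧ ∀ i j, 0 ≤ w i j

/-- The simple graph whose edges are the pairs of distinct nodes of positive weight. -/
def weightGraph {V : Type} (w : V → V → ℝ) : SimpleGraph V :=
  SimpleGraph.fromRel (fun i j => 0 < w i j)

/-- The Laplacian matrix of the weights `w`. -/
def laplacian {V : Type} [Fintype V] [DecidableEq V] (w : V → V → ℝ) : Matrix V V ℝ :=
  Matrix.of fun i j => if i = j then ∑ l ∈ Finset.univ.erase i, w i l else -w i j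

/-- `L` is the Laplacian matrix of a connected undirected weighted graph. -/
def IsConnectedLaplacian {V : Type} [Fintype V] [DecidableEq V] (L : Matrix V V ℝ) : Prop :=
  ∃ w : V → V → ℝ, IsUndirectedWeight w ∧ (weightGraph w).Connected ∧ L = laplacian w

/-- The system `ẋ = (I ⊗ A - L ⊗ B C) x + (F ⊗ B) u`, `y = (H ⊗ C) x`. -/
def network {V ι μ π θ : Type} [DecidableEq V] [Fintype μ]
    (S : LTI ι μ μ) (L : Matrix V V ℝ) (F : Matrix V π ℝ) (H : Matrix θ V ℝ) :
    LTI (V × ι) (π × μ) (θ × μ) where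
  A := (1 : Matrix V V ℝ) ⊗ₖ S.A - L ⊗ₖ (S.B * S.C)
  B := F ⊗ₖ S.B
  C := H ⊗ₖ S.C

/-! ### Balanced truncation -/

/-- `L = T diag(λ₁, …, λ_{N-1}, 0) Tᵀ` with `T = [T₁, 1_N / √N]` orthogonal and
`λ₁ ≥ ⋯ ≥ λ_{N-1} > 0`. -/
structure IsSpectralDecomp {N : ℕ} (L : Matrix (Fin N) (Fin N) ℝ)
    (T₁ : Matrix (Fin N) (Fin (N - 1)) ℝ) (lam : Fin (N - 1) → ℝ) : Prop where
  antitone : Antitone lam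
  pos : ∀ i, 0 < lam i
  orth_left : (fromCols T₁ (replicateCol Unit fun _ => 1 / √(N : ℝ)))ᵀ *
    fromCols T₁ (replicateCol Unit fun _ => 1 / √(N : ℝ)) = 1
  orth_right : fromCols T₁ (replicateCol Unit fun _ => 1 / √(N : ℝ)) *
    (fromCols T₁ (replicateCol Unit fun _ => 1 / √(N : ℝ)))ᵀ = 1
  decomp : L = fromCols T₁ (replicateCol Unit fun _ => 1 / √(N : ℝ)) *
    fromBlocks (diagonal lam) 0 0 (0 : Matrix Unit Unit ℝ) *
    (fromCols T₁ (replicateCol Unit fun _ => 1 / √(N : ℝ)))ᵀ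

/-- `X > 0` solves `-Λ X - X Λ + F̄ F̄ᵀ = 0`, and `Y > 0` solves `-Λ Y - Y Λ + H̄ᵀ H̄ ≤ 0` and is
block diagonal with one block for each distinct value of `λ`; here `Λ = diag(λ)`. -/
structure AreNetworkGramians {M p q : ℕ} (lam : Fin M → ℝ) (Fbar : Matrix (Fin M) (Fin p) ℝ)
    (Hbar : Matrix (Fin q) (Fin M) ℝ) (X Y : Matrix (Fin M) (Fin M) ℝ) : Prop where
  posDef_X : X.PosDef
  lyap_X : -(diagonal lam * X) - X * diagonal lam + Fbar * Fbarᵀ = 0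
  posDef_Y : Y.PosDef
  block_Y : ∀ i j, lam i ≠ lam j → Y i j = 0
  lyap_Y : (-(-(diagonal lam * Y) - Y * diagonal lam + Hbarᵀ * Hbar)).PosSemidef

/-- The nonsingular `T` balances `(P, Q)`: `T P Tᵀ = T⁻ᵀ Q T⁻¹ = diag(σ₁, …, σ_M)` with
`σ₁ ≥ ⋯ ≥ σ_M`. -/
structure IsBalancing {M : ℕ} (P Q T : Matrix (Fin M) (Fin M) ℝ) (σ : Fin M → ℝ) : Prop where
  nonsing : IsUnit T
  antitone : Antitone σ
  left : T * P * Tᵀ = diagonal σ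
  right : (T⁻¹)ᵀ * Q * T⁻¹ = diagonal σ

/-- Truncation in the coordinates given by `T`: the first `r` states of
`(T A T⁻¹, T B, C T⁻¹)` are kept. -/
noncomputable def LTI.truncate {n r : ℕ} {υ ο : Type} (S : LTI (Fin n) υ ο)
    (T : Matrix (Fin n) (Fin n) ℝ) (h : r ≤ n) : LTI (Fin r) υ ο where
  A := (T * S.A * T⁻¹).submatrix (Fin.castLE h) (Fin.castLE h)
  B := (T * S.B).submatrix (Fin.castLE h) id
  C := (S.C * T⁻¹).submatrix id (Fin.castLE h)

/-- `𝒩 = diag(Λ̂₁, 0)`, where `R = (Λ̂₁, F̂₁, Ĥ₁)`. -/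
def coupledN {M p q : ℕ} (R : LTI (Fin M) (Fin p) (Fin q)) :
    Matrix (Fin M ⊕ Unit) (Fin M ⊕ Unit) ℝ :=
  fromBlocks R.A 0 0 0

/-- `ℱ = [F̂₁; 1_Nᵀ F / √N]`, where `R = (Λ̂₁, F̂₁, Ĥ₁)`. -/
noncomputable def coupledF {M N p q : ℕ} (R : LTI (Fin M) (Fin p) (Fin q))
    (F : Matrix (Fin N) (Fin p) ℝ) : Matrix (Fin M ⊕ Unit) (Fin p) ℝ :=
  fromRows R.B (replicateRow Unit ((1 / √(N : ℝ)) • ((fun _ => 1) ᵥ* F)))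

/-- `ℋ = [Ĥ₁, H 1_N / √N]`, where `R = (Λ̂₁, F̂₁, Ĥ₁)`. -/
noncomputable def coupledH {M N p q : ℕ} (R : LTI (Fin M) (Fin p) (Fin q))
    (H : Matrix (Fin q) (Fin N) ℝ) : Matrix (Fin q) (Fin M ⊕ Unit) ℝ :=
  fromCols R.C (replicateCol Unit ((1 / √(N : ℝ)) • (H *ᵥ fun _ => 1)))

/-- `γ = 2 ∑_{i=k}^{N-1} ∑_{j=1}^{n} σᵢ τⱼ + 2 ∑_{i=1}^{k-1} ∑_{j=r+1}^{n} σᵢ τⱼ`; the indices of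
`σ` and `τ` start at `0` in the code. -/
noncomputable def errorBound {N n : ℕ} (k r : ℕ) (σ : Fin (N - 1) → ℝ) (τ : Fin n → ℝ) : ℝ :=
  2 * (∑ i : Fin (N - 1) with k - 1 ≤ i.val, ∑ j : Fin n, σ i * τ j) +
  2 * (∑ i : Fin (N - 1) with i.val < k - 1, ∑ j : Fin n with r ≤ j.val, σ i * τ j)

end NetworkBT

open NetworkBT

/-! The link between graph and agents is a Kronecker product of certificates. If `K B = Cᵀ` with `Aᵀ
K + K A ≤ 0`, and `Lᵀ G + G L ≥ Hᵀ H`, then the coupling term turns into `Cᵀ C`, and the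
observability Lyapunov inequality of the network for `G ⊗ K` splits into Kronecker products of
semidefinite matrices (`network_lyapunov`). Controllability is treated in inverse form: `X⁻¹ ⊗ Kmax`
satisfies the same kind of inequality, with output `Bᵀ` times that matrix. After balancing, both
certificates become diagonal, with entries `σᵢ τⱼ` and their inverses (`isBalancedBy_network`).

The reduced stable part keeps a product set of states of this balanced network. The error bound
comes from discarding the other states one at a time; each costs at most twice its diagonal entry
(`LTI.IsBalancedBy.output_le`), by a frequency-domain estimate valid for every `s` with positive
real part. Discarded states are masked rather than deleted, so that all intermediate systems live in
one state space and share one pair of Lyapunov inequalities.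

The equality of the two distances holds because the average mode is decoupled in the coordinates of
`𝒩` and is either unobservable or uncontrollable, so it does not enter the transfer function
(`transfer_network_coupled`). Invertibility of every `s I - A` involved follows from a Lyapunov
certificate. -/

namespace NetworkBT

/-! ### Real quadratic forms at complex vectors -/

section Complexification
variable {ι κ ο : Type}

lemma map_ofReal_mul [Fintype κ] (M : Matrix ι κ ℝ) (N : Matrix κ ο ℝ) :
    (M * N).map Complex.ofReal = M.map Complex.ofReal * N.map Complex.ofReal :=
  Matrix.map_mul (f := Complex.ofRealHom)

lemma map_ofReal_add (M N : Matrix ι κ ℝ) :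
    (M + N).map Complex.ofReal = M.map Complex.ofReal + N.map Complex.ofReal := by
  ext; simp

lemma map_ofReal_neg (M : Matrix ι κ ℝ) :
    (-M).map Complex.ofReal = -M.map Complex.ofReal := by
  ext; simp

lemma map_ofReal_transpose (M : Matrix ι κ ℝ) :
    Mᵀ.map Complex.ofReal = (M.map Complex.ofReal)ᴴ := by
  ext; simp

lemma map_ofReal_diagonal [DecidableEq ι] (d : ι → ℝ) :
    (diagonal d).map Complex.ofReal = diagonal fun i => (d i : ℂ) := by
  ext i j; by_cases h : i = j <;> simp [h]

lemma transpose_eq_of_posDef {M : Matrix ι ι ℝ} (hM : M.PosDef) : Mᵀ = M := by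
  rw [← conjTranspose_eq_transpose_of_trivial]
  exact hM.isHermitian

variable [Fintype ι] [Fintype κ]

/-- The cross terms between real and imaginary parts are purely imaginary. Hence real semidefinite
inequalities carry over to complex vectors. -/
lemma re_star_dotProduct_mulVec (M : Matrix ι ι ℝ) (v : ι → ℂ) :
    (star v ⬝ᵥ (M.map Complex.ofReal *ᵥ v)).re =
      (fun i => (v i).re) ⬝ᵥ (M *ᵥ fun i => (v i).re) +
      (fun i => (v i).im) ⬝ᵥ (M *ᵥ fun i => (v i).im) := by
  simp [dotProduct, mulVec, Finset.sum_add_distrib]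

lemma re_star_dotProduct_transpose_mulVec (M : Matrix ι ι ℝ) (v : ι → ℂ) :
    (star v ⬝ᵥ (Mᵀ.map Complex.ofReal *ᵥ v)).re =
      (star v ⬝ᵥ (M.map Complex.ofReal *ᵥ v)).re := by
  have h (a : ι → ℝ) : a ⬝ᵥ (Mᵀ *ᵥ a) = a ⬝ᵥ (M *ᵥ a) := by
    rw [mulVec_transpose, dotProduct_comm, ← dotProduct_mulVec]
  rw [re_star_dotProduct_mulVec, re_star_dotProduct_mulVec, h, h]

lemma re_star_dotProduct_nonneg {M : Matrix ι ι ℝ} (hM : M.PosSemidef) (v : ι → ℂ) :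
    0 ≤ (star v ⬝ᵥ (M.map Complex.ofReal *ᵥ v)).re := by
  rw [re_star_dotProduct_mulVec]
  have h1 := hM.dotProduct_mulVec_nonneg (fun i => (v i).re)
  have h2 := hM.dotProduct_mulVec_nonneg (fun i => (v i).im)
  simp only [star_trivial] at h1 h2
  exact add_nonneg h1 h2

lemma re_star_dotProduct_pos {M : Matrix ι ι ℝ} (hM : M.PosDef) {v : ι → ℂ} (hv : v ≠ 0) :
    0 < (star v ⬝ᵥ (M.map Complex.ofReal *ᵥ v)).re := by
  rw [re_star_dotProduct_mulVec]
  have h1 := hM.posSemidef.dotProduct_mulVec_nonneg (fun i => (v i).re)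
  have h2 := hM.posSemidef.dotProduct_mulVec_nonneg (fun i => (v i).im)
  simp only [star_trivial] at h1 h2
  by_cases hr : (fun i => (v i).re) = 0
  · have hi : (fun i => (v i).im) ≠ 0 := fun hi => hv <| funext fun i =>
      Complex.ext (congrFun hr i) (congrFun hi i)
    exact add_pos_of_nonneg_of_pos h1 (by simpa using hM.dotProduct_mulVec_pos hi)
  · exact add_pos_of_pos_of_nonneg (by simpa using hM.dotProduct_mulVec_pos hr) h2

/-- The Lyapunov inequality `Aᵀ Q + Q A + Cᵀ C ≤ 0`, evaluated at a complex vector. -/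
lemma lyapunov_re_le {A Q : Matrix ι ι ℝ} {C : Matrix κ ι ℝ} (hQ : Qᵀ = Q)
    (h : (-(Aᵀ * Q + Q * A + Cᵀ * C)).PosSemidef) (v : ι → ℂ) :
    2 * (star v ⬝ᵥ ((Q * A).map Complex.ofReal *ᵥ v)).re +
      (star (C.map Complex.ofReal *ᵥ v) ⬝ᵥ (C.map Complex.ofReal *ᵥ v)).re ≤ 0 := by
  have h0 := re_star_dotProduct_nonneg h v
  have h1 : Aᵀ * Q = (Q * A)ᵀ := by rw [transpose_mul, hQ]
  have h2 : star v ⬝ᵥ ((Cᵀ * C).map Complex.ofReal *ᵥ v) =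
      star (C.map Complex.ofReal *ᵥ v) ⬝ᵥ (C.map Complex.ofReal *ᵥ v) := by
    rw [map_ofReal_mul, map_ofReal_transpose, ← mulVec_mulVec, dotProduct_mulVec, star_mulVec]
  rw [h1, map_ofReal_neg, map_ofReal_add, map_ofReal_add, neg_mulVec, add_mulVec, add_mulVec,
    dotProduct_neg, dotProduct_add, dotProduct_add, h2] at h0
  simp only [Complex.neg_re, Complex.add_re, re_star_dotProduct_transpose_mulVec] at h0
  linarith

lemma re_star_dotProduct_self (v : ι → ℂ) : (star v ⬝ᵥ v).re = ‖WithLp.toLp 2 v‖ ^ 2 := by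
  simp [EuclideanSpace.norm_sq_eq, dotProduct, ← Complex.normSq_eq_norm_sq, Complex.normSq_apply]

open scoped Matrix.Norms.L2Operator in
lemma l2_opNorm_le_of_mulVec_le [DecidableEq κ] {M : Matrix ι κ ℂ} {c : ℝ} (hc : 0 ≤ c)
    (h : ∀ u : κ → ℂ, (star (M *ᵥ u) ⬝ᵥ (M *ᵥ u)).re ≤ c ^ 2 * (star u ⬝ᵥ u).re) : ‖M‖ ≤ c := by
  rw [l2_opNorm_def]
  refine ContinuousLinearMap.opNorm_le_bound _ hc fun u => ?_
  have := h u.ofLp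
  rw [re_star_dotProduct_self, re_star_dotProduct_self, ← mul_pow] at this
  exact le_of_sq_le_sq this (by positivity)

lemma re_star_dotProduct_diagonal (d : ι → ℝ) (s : ℂ) (v : ι → ℂ) :
    (∑ i, star (v i) * d i * (s * v i)).re = s.re * ∑ i, d i * Complex.normSq (v i) := by
  rw [Complex.re_sum, Finset.mul_sum]
  refine Finset.sum_congr rfl fun i _ => ?_
  simp [Complex.normSq_apply]
  ring

end Complexification

/-! ### Invertibility of `s I - A` and masked systems -/

section Resolvent
variable {ι υ ο : Type} [Fintype ι] [DecidableEq ι]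

/-- The matrix `s I - A`, whose inverse is the resolvent of `A`. -/
noncomputable def LTI.pencil (S : LTI ι υ ο) (s : ℂ) : Matrix ι ι ℂ :=
  s • (1 : Matrix ι ι ℂ) - S.A.map Complex.ofReal

lemma isUnit_of_mulVec_eq_zero {M : Matrix ι ι ℂ} (h : ∀ v, M *ᵥ v = 0 → v = 0) : IsUnit M := by
  rw [← mulVec_injective_iff_isUnit]
  intro v w hvw
  exact sub_eq_zero.1 (h _ (by rw [mulVec_sub, sub_eq_zero]; exact hvw))

lemma LTI.pencil_mulVec (S : LTI ι υ ο) (s : ℂ) (v : ι → ℂ) :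
    S.pencil s *ᵥ v = s • v - S.A.map Complex.ofReal *ᵥ v := by
  rw [pencil, sub_mulVec, smul_mulVec, one_mulVec]

/-- An eigenvector `v` for `s` would give `Re s · v* Q v ≤ 0`, since `v* Q v` is real. -/
lemma LTI.isUnit_pencil (S : LTI ι υ ο) {Q : Matrix ι ι ℝ} (hQ : Q.PosDef)
    (h : (-(S.Aᵀ * Q + Q * S.A)).PosSemidef) {s : ℂ} (hs : 0 < s.re) : IsUnit (S.pencil s) := by
  refine isUnit_of_mulVec_eq_zero fun v hv => ?_
  by_contra hne
  rw [LTI.pencil_mulVec, sub_eq_zero] at hv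
  have h1 := lyapunov_re_le (C := (0 : Matrix ι ι ℝ)) (A := S.A) (transpose_eq_of_posDef hQ)
    (by simpa using h) v
  rw [map_ofReal_mul, ← mulVec_mulVec, ← hv, mulVec_smul, dotProduct_smul] at h1
  have h2 := re_star_dotProduct_pos hQ hne
  have h3 : (star v ⬝ᵥ (Q.map Complex.ofReal *ᵥ v)).im = 0 := by
    have h4 : (Q.map Complex.ofReal).IsHermitian := by
      rw [Matrix.IsHermitian, ← map_ofReal_transpose, transpose_eq_of_posDef hQ]
    exact h4.im_star_dotProduct_mulVec_self v
  have h5 : ((0 : Matrix ι ι ℝ).map Complex.ofReal) = 0 := by ext; simp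
  simp only [smul_eq_mul, Complex.mul_re, h3, h5, zero_mulVec, dotProduct_zero,
    Complex.zero_re] at h1
  nlinarith [mul_pos hs h2]

/-- The states outside `t` are switched off. -/
def LTI.mask (S : LTI ι υ ο) (t : Finset ι) : LTI ι υ ο where
  A := diagonal (fun i => if i ∈ t then (1 : ℝ) else 0) * S.A
  B := diagonal (fun i => if i ∈ t then (1 : ℝ) else 0) * S.B
  C := S.C

lemma LTI.mask_univ (S : LTI ι υ ο) : S.mask Finset.univ = S := by
  simp [mask]

lemma LTI.mask_A_mulVec (S : LTI ι υ ο) (t : Finset ι) (v : ι → ℂ) :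
    (S.mask t).A.map Complex.ofReal *ᵥ v =
      fun i => if i ∈ t then (S.A.map Complex.ofReal *ᵥ v) i else 0 := by
  ext i
  simp only [mask, map_ofReal_mul, map_ofReal_diagonal, ← mulVec_mulVec, mulVec_diagonal]
  split_ifs <;> simp

lemma LTI.mask_B_mulVec [Fintype υ] (S : LTI ι υ ο) (t : Finset ι) (u : υ → ℂ) :
    (S.mask t).B.map Complex.ofReal *ᵥ u =
      fun i => if i ∈ t then (S.B.map Complex.ofReal *ᵥ u) i else 0 := by
  ext i
  simp only [mask, map_ofReal_mul, map_ofReal_diagonal, ← mulVec_mulVec, mulVec_diagonal]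
  split_ifs <;> simp

lemma star_dotProduct_diagonal_mul (d : ι → ℝ) (M : Matrix ι ι ℝ) (v : ι → ℂ) :
    star v ⬝ᵥ ((diagonal d * M).map Complex.ofReal *ᵥ v) =
      ∑ i, star (v i) * d i * (M.map Complex.ofReal *ᵥ v) i := by
  rw [map_ofReal_mul, map_ofReal_diagonal, ← mulVec_mulVec]
  simp [dotProduct, mulVec_diagonal, mul_assoc]

/-- A kernel vector vanishes off `t` because `s ≠ 0`, and there the masked rows do not matter. As
the weight is diagonal, the unmasked Lyapunov inequality therefore still applies. -/
lemma LTI.isUnit_pencil_mask (S : LTI ι υ ο) {d : ι → ℝ} (hd : ∀ i, 0 < d i)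
    (h : (-(S.Aᵀ * diagonal d + diagonal d * S.A)).PosSemidef) (t : Finset ι)
    {s : ℂ} (hs : 0 < s.re) : IsUnit ((S.mask t).pencil s) := by
  refine isUnit_of_mulVec_eq_zero fun v hv => ?_
  rw [LTI.pencil_mulVec, sub_eq_zero, LTI.mask_A_mulVec] at hv
  have h1 := lyapunov_re_le (C := (0 : Matrix ι ι ℝ)) (A := S.A) (diagonal_transpose d)
    (by simpa using h) v
  have h5 : ((0 : Matrix ι ι ℝ).map Complex.ofReal) = 0 := by ext; simp
  have hs0 : s ≠ 0 := fun h => by simp [h] at hs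
  have h6 : ∀ i, star (v i) * d i * (S.A.map Complex.ofReal *ᵥ v) i =
      star (v i) * d i * (s * v i) := fun i => by
    have := congrFun hv i
    by_cases hi : i ∈ t
    · simp only [Pi.smul_apply, smul_eq_mul, hi, if_true] at this
      rw [this]
    · simp only [Pi.smul_apply, smul_eq_mul, hi, if_false, mul_eq_zero, hs0, false_or] at this
      simp [this]
  simp only [star_dotProduct_diagonal_mul, h6, re_star_dotProduct_diagonal, h5, zero_mulVec,
    dotProduct_zero, Complex.zero_re] at h1
  have h7 : ∀ i ∈ Finset.univ, 0 ≤ d i * Complex.normSq (v i) := fun i _ =>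
    mul_nonneg (hd i).le (Complex.normSq_nonneg _)
  have h8 : ∑ i, d i * Complex.normSq (v i) = 0 :=
    le_antisymm (by nlinarith) (Finset.sum_nonneg h7)
  ext i
  have := (Finset.sum_eq_zero_iff_of_nonneg h7).1 h8 i (Finset.mem_univ i)
  simpa [(hd i).ne'] using this

lemma LTI.transfer_mulVec [Fintype υ] (S : LTI ι υ ο) {s : ℂ} (h : IsUnit (S.pencil s))
    (u : υ → ℂ) : ∃ x : ι → ℂ,
      s • x = S.A.map Complex.ofReal *ᵥ x + S.B.map Complex.ofReal *ᵥ u ∧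
      S.transfer s *ᵥ u = S.C.map Complex.ofReal *ᵥ x := by
  refine ⟨(S.pencil s)⁻¹ *ᵥ (S.B.map Complex.ofReal *ᵥ u), ?_, ?_⟩
  · rw [← sub_eq_iff_eq_add', ← LTI.pencil_mulVec, mulVec_mulVec,
      Matrix.mul_nonsing_inv _ ((Matrix.isUnit_iff_isUnit_det _).1 h), one_mulVec]
  · simp only [transfer, pencil, mulVec_mulVec, Matrix.mul_assoc]

end Resolvent

/-! ### Error bound for truncating a balanced system -/

section Truncation
variable {ι υ ο : Type} [Fintype ι] [DecidableEq ι] [Fintype υ] [Fintype ο]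

/-- `D = diag(d)` is a generalized Gramian for both controllability and observability. -/
structure LTI.IsBalancedBy (S : LTI ι υ ο) (d : ι → ℝ) : Prop where
  pos : ∀ i, 0 < d i
  obs : (-(S.Aᵀ * diagonal d + diagonal d * S.A + S.Cᵀ * S.C)).PosSemidef
  ctrl : (-(S.Aᵀ * diagonal d⁻¹ + diagonal d⁻¹ * S.A +
    (S.Bᵀ * diagonal d⁻¹)ᵀ * (S.Bᵀ * diagonal d⁻¹))).PosSemidef

lemma LTI.IsBalancedBy.lyapunov {S : LTI ι υ ο} {d : ι → ℝ} (h : S.IsBalancedBy d) :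
    (-(S.Aᵀ * diagonal d + diagonal d * S.A)).PosSemidef := by
  have := h.obs.add (posSemidef_conjTranspose_mul_self S.C)
  rw [conjTranspose_eq_transpose_of_trivial] at this
  convert this using 1
  abel

/-- Switching off one more state changes the output by at most `2 dₐ ‖u‖`. -/
lemma LTI.IsBalancedBy.output_le {S : LTI ι υ ο} {d : ι → ℝ} (h : S.IsBalancedBy d)
    {t : Finset ι} {a : ι} (ha : a ∉ t) {s : ℂ} (hs : 0 < s.re) {u : υ → ℂ} {x z : ι → ℂ}
    (hx : s • x = (S.mask (insert a t)).A.map Complex.ofReal *ᵥ x +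
      (S.mask (insert a t)).B.map Complex.ofReal *ᵥ u)
    (hz : s • z = (S.mask t).A.map Complex.ofReal *ᵥ z + (S.mask t).B.map Complex.ofReal *ᵥ u) :
    (star (S.C.map Complex.ofReal *ᵥ (x - z)) ⬝ᵥ (S.C.map Complex.ofReal *ᵥ (x - z))).re ≤
      (2 * d a) ^ 2 * (star u ⬝ᵥ u).re := by
  have hs0 : s ≠ 0 := fun h => by simp [h] at hs
  set A := S.A.map Complex.ofReal with hA
  -- `g` and `f` below are the right-hand sides of the unmasked state equation at `x` and `z`.
  set B := S.B.map Complex.ofReal with hB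
  set g : ι → ℂ := A *ᵥ x + B *ᵥ u with hg
  set f : ι → ℂ := A *ᵥ z + B *ᵥ u with hf
  rw [mask_A_mulVec, mask_B_mulVec] at hx hz
  have hx' : ∀ i, s * x i = if i ∈ insert a t then g i else 0 := fun i => by
    have := congrFun hx i
    simp only [Pi.smul_apply, smul_eq_mul, Pi.add_apply] at this
    rw [this]; split_ifs <;> simp [hg, hA, hB]
  have hz' : ∀ i, s * z i = if i ∈ t then f i else 0 := fun i => by
    have := congrFun hz i
    simp only [Pi.smul_apply, smul_eq_mul, Pi.add_apply] at this
    rw [this]; split_ifs <;> simp [hf, hA, hB]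
  have hx0 : ∀ i, i ∉ insert a t → x i = 0 := fun i hi => by
    have := hx' i
    rwa [if_neg hi, mul_eq_zero, or_iff_right hs0] at this
  have hz0 : ∀ i, i ∉ t → z i = 0 := fun i hi => by
    have := hz' i
    rwa [if_neg hi, mul_eq_zero, or_iff_right hs0] at this
  set c : ℂ := star (x a) * f a with hc
  -- Only coordinate `a` violates the unmasked equation: there `z` vanishes, `s x a = g a`, and `f
  -- a` is left over. The defect `c` enters with opposite signs for `x - z` and `x + z`, which lets
  -- it be eliminated.
  have key : ∀ (e : ι → ℝ) (ε : ℂ), (ε = 1 ∨ ε = -1) →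
      ∑ i, star ((x - ε • z) i) * e i * (s * (x - ε • z) i) =
        ∑ i, star ((x - ε • z) i) * e i * (g - ε • f) i + e a * (ε * c) := by
    intro e ε hε
    have : e a * (ε * c) = ∑ i, if i = a then e a * (ε * c) else 0 := by simp
    rw [this, ← Finset.sum_add_distrib]
    refine Finset.sum_congr rfl fun i _ => ?_
    simp only [Pi.sub_apply, Pi.smul_apply, smul_eq_mul, mul_sub]
    rw [mul_left_comm s ε, hx' i, hz' i]
    by_cases hi : i ∈ t
    · have : i ≠ a := fun h => ha (h ▸ hi)
      simp [hi, this]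
    · by_cases hia : i = a
      · subst hia
        simp [hi, hz0 i hi, hc]
        ring
      · simp [hi, hia, hz0 i hi, hx0 i (by simp [hi, hia])]
  have nonneg : ∀ (e : ι → ℝ) (v : ι → ℂ), (∀ i, 0 < e i) →
      0 ≤ (∑ i, star (v i) * e i * (s * v i)).re := fun e v he => by
    rw [re_star_dotProduct_diagonal]
    exact mul_nonneg hs.le (Finset.sum_nonneg fun i _ =>
      mul_nonneg (he i).le (Complex.normSq_nonneg _))
  -- The input cancels in `x - z`, so the observability inequality bounds the squared output
  -- difference by `2 dₐ Re c`.
  have o := lyapunov_re_le (diagonal_transpose d) h.obs (x - z)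
  rw [star_dotProduct_diagonal_mul] at o
  have ko := key d 1 (Or.inl rfl)
  have no := nonneg d (x - z) h.pos
  have e1 : g - f = A *ᵥ (x - z) := by rw [mulVec_sub]; simp [hg, hf]
  rw [one_smul, one_smul, e1, one_mul] at ko
  rw [ko, Complex.add_re, Complex.re_ofReal_mul] at no
  -- The input doubles in `x + z`, so the controllability inequality bounds `Re c / dₐ` by `2 Re (v*
  -- u) - ‖v‖² / 2`.
  have p := lyapunov_re_le (diagonal_transpose d⁻¹) h.ctrl (x + z)
  rw [star_dotProduct_diagonal_mul] at p
  have kp := key d⁻¹ (-1) (Or.inr rfl)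
  have np := nonneg d⁻¹ (x + z) fun i => inv_pos.2 (h.pos i)
  have e2 : g + f = A *ᵥ (x + z) + (2 : ℂ) • (B *ᵥ u) := by
    rw [mulVec_add, two_smul]; simp only [hg, hf]; abel
  simp only [neg_smul, one_smul, sub_neg_eq_add, e2] at kp
  set v := (S.Bᵀ * diagonal d⁻¹).map Complex.ofReal *ᵥ (x + z) with hv
  have e3 : ∑ i, star ((x + z) i) * (d⁻¹ i : ℝ) * (A *ᵥ (x + z) + (2 : ℂ) • (B *ᵥ u)) i =
      ∑ i, star ((x + z) i) * (d⁻¹ i : ℝ) * (A *ᵥ (x + z)) i + 2 * (star v ⬝ᵥ u) := by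
    have : star v ⬝ᵥ u = ∑ i, star ((x + z) i) * (d⁻¹ i : ℝ) * (B *ᵥ u) i := by
      rw [hv, star_mulVec, ← dotProduct_mulVec, ← map_ofReal_transpose, transpose_mul,
        transpose_transpose, diagonal_transpose, map_ofReal_mul, map_ofReal_diagonal,
        ← mulVec_mulVec]
      simp [dotProduct, mulVec_diagonal, mul_assoc, hB]
    rw [this, Finset.mul_sum, ← Finset.sum_add_distrib]
    refine Finset.sum_congr rfl fun i _ => ?_
    simp only [Pi.add_apply, Pi.smul_apply, smul_eq_mul]
    ring
  rw [kp, e3, Complex.add_re, Complex.add_re, Complex.re_ofReal_mul] at np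
  -- Completing the square: this turns the previous bound into `Re c ≤ 2 dₐ ‖u‖²`.
  have e4 : 0 ≤ (star (v - (2 : ℂ) • u) ⬝ᵥ (v - (2 : ℂ) • u)).re := by
    rw [re_star_dotProduct_self]; positivity
  have e5 : (star u ⬝ᵥ v).re = (star v ⬝ᵥ u).re := by
    simp only [dotProduct, Complex.re_sum]
    refine Finset.sum_congr rfl fun i _ => ?_
    simp; ring
  have e6 : (star (v - (2 : ℂ) • u) ⬝ᵥ (v - (2 : ℂ) • u)).re =
      (star v ⬝ᵥ v).re - 4 * (star v ⬝ᵥ u).re + 4 * (star u ⬝ᵥ u).re := by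
    simp only [star_sub, star_smul, sub_dotProduct, dotProduct_sub, smul_dotProduct,
      dotProduct_smul, Complex.sub_re, smul_eq_mul]
    simp [e5]
    ring
  have e7 : (2 * (star v ⬝ᵥ u)).re = 2 * (star v ⬝ᵥ u).re := by simp
  have e8 : ((-1 : ℂ) * c).re = -c.re := by simp
  rw [e6] at e4
  rw [e7, e8] at np
  have hda := h.pos a
  have q1 : d⁻¹ a * c.re ≤ 2 * (star u ⬝ᵥ u).re := by nlinarith
  have q2 : c.re ≤ d a * (2 * (star u ⬝ᵥ u).re) := by
    rw [Pi.inv_apply, inv_mul_le_iff₀ hda] at q1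
    exact q1
  have q3 := mul_le_mul_of_nonneg_left q2 hda.le
  nlinarith

open scoped Matrix.Norms.L2Operator in
lemma LTI.IsBalancedBy.norm_transfer_mask_insert_sub_le [DecidableEq υ] {S : LTI ι υ ο}
    {d : ι → ℝ} (h : S.IsBalancedBy d) {t : Finset ι} {a : ι} (ha : a ∉ t) {s : ℂ}
    (hs : 0 < s.re) :
    ‖(S.mask (insert a t)).transfer s - (S.mask t).transfer s‖ ≤ 2 * d a := by
  refine l2_opNorm_le_of_mulVec_le (by have := h.pos a; positivity) fun u => ?_
  obtain ⟨x, hx, hx'⟩ := (S.mask (insert a t)).transfer_mulVec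
    (S.isUnit_pencil_mask h.pos h.lyapunov _ hs) u
  obtain ⟨z, hz, hz'⟩ := (S.mask t).transfer_mulVec
    (S.isUnit_pencil_mask h.pos h.lyapunov _ hs) u
  have := h.output_le ha hs hx hz
  rw [sub_mulVec, hx', hz']
  rw [mulVec_sub] at this
  exact this

open scoped Matrix.Norms.L2Operator in
/-- The error bound of balanced truncation, at a point of the open right half-plane. -/
lemma LTI.IsBalancedBy.norm_transfer_sub_mask_le [DecidableEq υ] {S : LTI ι υ ο}
    {d : ι → ℝ} (h : S.IsBalancedBy d) (t : Finset ι) {s : ℂ} (hs : 0 < s.re) :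
    ‖S.transfer s - (S.mask t).transfer s‖ ≤ 2 * ∑ i ∈ tᶜ, d i := by
  -- The states of `t'` are switched back on one by one; `t' = tᶜ` recovers the full system.
  suffices H : ∀ t' : Finset ι, Disjoint t t' →
      ‖(S.mask (t ∪ t')).transfer s - (S.mask t).transfer s‖ ≤ 2 * ∑ i ∈ t', d i by
    have := H tᶜ disjoint_compl_right
    rwa [Finset.union_compl, LTI.mask_univ] at this
  intro t'
  induction t' using Finset.induction_on with
  | empty => simp
  | insert a t' ha ih =>
    intro hdis
    rw [Finset.disjoint_insert_right] at hdis
    rw [Finset.union_insert, Finset.sum_insert ha, mul_add]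
    exact (norm_sub_le_norm_sub_add_norm_sub _ _ _).trans (add_le_add
      (h.norm_transfer_mask_insert_sub_le (by simp [ha, hdis.1]) hs) (ih hdis.2))

end Truncation

end NetworkBT

namespace NetworkBT

/-! ### Systems related by an intertwining matrix -/

section Intertwining
variable {ι κ υ ο : Type} [Fintype ι] [DecidableEq ι] [Fintype κ] [DecidableEq κ]

/-- `E` also intertwines the resolvents. It may be rectangular, so similarity, masking, and removal
of uncontrollable or unobservable states are all instances. -/
lemma transfer_eq_of_intertwining {S' : LTI κ υ ο} {S : LTI ι υ ο} (E : Matrix κ ι ℝ)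
    (hA : S'.A * E = E * S.A) (hB : S'.B = E * S.B) (hC : S'.C * E = S.C) {s : ℂ}
    (h' : IsUnit (S'.pencil s)) (h : IsUnit (S.pencil s)) : S'.transfer s = S.transfer s := by
  rw [Matrix.isUnit_iff_isUnit_det] at h h'
  have hE : S'.pencil s * E.map Complex.ofReal = E.map Complex.ofReal * S.pencil s := by
    rw [LTI.pencil, LTI.pencil, Matrix.sub_mul, Matrix.mul_sub, ← map_ofReal_mul, ← map_ofReal_mul,
      hA]
    simp
  have hE' : (S'.pencil s)⁻¹ * E.map Complex.ofReal = E.map Complex.ofReal * (S.pencil s)⁻¹ := by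
    rw [← Matrix.mul_nonsing_inv_cancel_right (A := S.pencil s) ((S'.pencil s)⁻¹ * _) h,
      Matrix.mul_assoc _ _ (S.pencil s), ← hE, Matrix.nonsing_inv_mul_cancel_left _ _ h']
  change S'.C.map Complex.ofReal * (S'.pencil s)⁻¹ * S'.B.map Complex.ofReal =
    S.C.map Complex.ofReal * (S.pencil s)⁻¹ * S.B.map Complex.ofReal
  rw [hB, ← hC, map_ofReal_mul, map_ofReal_mul, Matrix.mul_assoc, ← Matrix.mul_assoc _ (E.map _),
    hE']
  simp only [Matrix.mul_assoc]

/-- The subsystem of the states in the image of `f`. -/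
def LTI.restrict (S : LTI ι υ ο) (f : κ → ι) : LTI κ υ ο where
  A := S.A.submatrix f f
  B := S.B.submatrix f id
  C := S.C.submatrix id f

lemma diagonal_image_mul {α : Type} (M : Matrix ι α ℝ) {f : κ → ι} (hf : f.Injective) :
    diagonal (fun i => if i ∈ Finset.univ.image f then (1 : ℝ) else 0) * M =
      (1 : Matrix ι ι ℝ).submatrix id f * M.submatrix f id := by
  ext i j
  rw [diagonal_mul, mul_apply]
  simp only [submatrix_apply, id_eq, one_apply, ite_mul, one_mul, zero_mul]
  by_cases hi : i ∈ Finset.univ.image f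
  · obtain ⟨l, -, rfl⟩ := Finset.mem_image.1 hi
    simp [hf.eq_iff]
  · rw [if_neg hi, Finset.sum_eq_zero]
    intro l _
    rw [if_neg]
    rintro rfl
    exact hi (Finset.mem_image_of_mem _ (Finset.mem_univ _))

lemma LTI.transfer_mask_image (S : LTI ι υ ο) {f : κ → ι} (hf : f.Injective) {s : ℂ}
    (h' : IsUnit ((S.mask (Finset.univ.image f)).pencil s)) (h : IsUnit ((S.restrict f).pencil s)) :
    (S.mask (Finset.univ.image f)).transfer s = (S.restrict f).transfer s := by
  have hE {α : Type} (M : Matrix α ι ℝ) :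
      M * (1 : Matrix ι ι ℝ).submatrix id f = M.submatrix id f := by
    ext; simp [mul_apply, one_apply]
  refine transfer_eq_of_intertwining ((1 : Matrix ι ι ℝ).submatrix id f) ?_ ?_ ?_ h' h
  · simp only [mask, restrict]
    rw [Matrix.mul_assoc, hE, diagonal_image_mul _ hf, submatrix_submatrix]
    rfl
  · exact diagonal_image_mul _ hf
  · exact hE _

end Intertwining

/-! ### Certificates for graph and agents, and their Kronecker product -/

section Gramians

/-- `G > 0` and `Lᵀ G + G L ≥ Hᵀ H`. -/
structure IsGraphGramian {V θ : Type} [Fintype V] [Fintype θ] (L G : Matrix V V ℝ)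
    (H : Matrix θ V ℝ) : Prop where
  posDef : G.PosDef
  lyap : (Lᵀ * G + G * L - Hᵀ * H).PosSemidef

variable {V V' ι ι' μ π θ : Type} [Fintype V] [DecidableEq V] [Fintype V'] [DecidableEq V']
  [Fintype ι] [DecidableEq ι] [Fintype ι'] [DecidableEq ι'] [Fintype μ] [Fintype π] [Fintype θ]

omit [DecidableEq V] in
lemma IsGraphGramian.zero_output {L G : Matrix V V ℝ} {H : Matrix θ V ℝ}
    (h : IsGraphGramian L G H) : IsGraphGramian L G (0 : Matrix θ V ℝ) := by
  refine ⟨h.posDef, ?_⟩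
  have := h.lyap.add (posSemidef_conjTranspose_mul_self H)
  rw [conjTranspose_eq_transpose_of_trivial] at this
  simpa using this

omit [DecidableEq V] in
lemma posDef_congr_of_inverse {G : Matrix V V ℝ} (hG : G.PosDef) {P : Matrix V V' ℝ}
    {Q : Matrix V' V ℝ} (hQP : Q * P = 1) : (Pᵀ * G * P).PosDef := by
  have := hG.conjTranspose_mul_mul_same (B := P) fun v w hvw => by
    have := congrArg (Q *ᵥ ·) hvw
    simpa [mulVec_mulVec, hQP] using this
  rwa [conjTranspose_eq_transpose_of_trivial] at this

lemma posSemidef_congr {ι κ : Type} [Fintype ι] [Fintype κ] {G : Matrix ι ι ℝ}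
    (hG : G.PosSemidef) (P : Matrix ι κ ℝ) : (Pᵀ * G * P).PosSemidef := by
  have := hG.conjTranspose_mul_mul_same P
  rwa [conjTranspose_eq_transpose_of_trivial] at this

omit [DecidableEq V'] in
-- The product `P Q`, or its transpose, sits in the middle of each term, so a one-sided inverse is
-- enough.
lemma lyapunov_congr {L G : Matrix V V ℝ} {P : Matrix V V' ℝ} {Q : Matrix V' V ℝ}
    (hPQ : P * Q = 1) :
    (Q * L * P)ᵀ * (Pᵀ * G * P) + Pᵀ * G * P * (Q * L * P) = Pᵀ * (Lᵀ * G + G * L) * P := by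
  have hPQ' : Qᵀ * Pᵀ = 1 := by rw [← transpose_mul, hPQ, transpose_one]
  have h1 : (Q * L * P)ᵀ * (Pᵀ * G * P) = Pᵀ * Lᵀ * (Qᵀ * Pᵀ) * G * P := by
    simp only [transpose_mul, Matrix.mul_assoc]
  have h2 : Pᵀ * G * P * (Q * L * P) = Pᵀ * G * (P * Q) * L * P := by
    simp only [Matrix.mul_assoc]
  rw [h1, h2, hPQ, hPQ', Matrix.mul_one, Matrix.mul_one, Matrix.mul_add, Matrix.add_mul]
  simp only [Matrix.mul_assoc]

lemma IsGraphGramian.congr {L G : Matrix V V ℝ} {H : Matrix θ V ℝ} (h : IsGraphGramian L G H)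
    {P : Matrix V V' ℝ} {Q : Matrix V' V ℝ} (hPQ : P * Q = 1) (hQP : Q * P = 1) :
    IsGraphGramian (Q * L * P) (Pᵀ * G * P) (H * P) := by
  refine ⟨posDef_congr_of_inverse h.posDef hQP, ?_⟩
  rw [lyapunov_congr hPQ]
  convert posSemidef_congr h.lyap P using 1
  rw [Matrix.mul_sub, Matrix.sub_mul, transpose_mul]
  simp only [Matrix.mul_assoc]

/-- The system in the coordinates `T x`. -/
noncomputable def LTI.changeBasis {υ ο : Type} (S : LTI ι υ ο) (T : Matrix ι ι ℝ) :
    LTI ι υ ο where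
  A := T * S.A * T⁻¹
  B := T * S.B
  C := S.C * T⁻¹

omit [Fintype μ] in
lemma LTI.IsKYPSolution.changeBasis {S : LTI ι μ μ} {K : Matrix ι ι ℝ} (h : S.IsKYPSolution K)
    {T : Matrix ι ι ℝ} (hT : IsUnit T) :
    (S.changeBasis T).IsKYPSolution ((T⁻¹)ᵀ * K * T⁻¹) := by
  have hd := (Matrix.isUnit_iff_isUnit_det _).1 hT
  have h1 := Matrix.mul_nonsing_inv _ hd
  have h2 := Matrix.nonsing_inv_mul _ hd
  refine ⟨posDef_congr_of_inverse h.1 h1, ?_, ?_⟩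
  · rw [LTI.changeBasis, lyapunov_congr h2, ← Matrix.neg_mul, ← Matrix.mul_neg]
    exact posSemidef_congr h.2.1 _
  · have h3 : Tᵀ * (T⁻¹)ᵀ = 1 := by rw [← transpose_mul, h2, transpose_one]
    simp only [LTI.changeBasis, h.2.2, transpose_mul]
    rw [Matrix.mul_assoc (T⁻¹)ᵀ, Matrix.mul_assoc S.Bᵀ Tᵀ, ← Matrix.mul_assoc Tᵀ (T⁻¹)ᵀ, h3,
      Matrix.one_mul, Matrix.mul_assoc]

omit [Fintype μ] in
-- With a diagonal storage matrix, the restricted Lyapunov expression is a submatrix of the full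
-- one. Thus truncation in balanced coordinates keeps the certificate.
lemma LTI.IsKYPSolution.restrict_diagonal {S : LTI ι μ μ} {d : ι → ℝ}
    (h : S.IsKYPSolution (diagonal d)) (f : ι' → ι) :
    (S.restrict f).IsKYPSolution (diagonal fun i => d (f i)) := by
  refine ⟨PosDef.diagonal fun i => (posDef_diagonal_iff.1 h.1) (f i), ?_, ?_⟩
  · convert h.2.1.submatrix f using 1
    ext i j
    simp [LTI.restrict, mul_diagonal, diagonal_mul]
  · have := h.2.2
    ext i j
    simpa [LTI.restrict, mul_diagonal] using congrFun (congrFun this i) (f j)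

omit [DecidableEq ι] [DecidableEq ι'] in
lemma IsGraphGramian.submatrix_diagonal {L : Matrix V V ℝ} {d : V → ℝ} {H : Matrix θ V ℝ}
    (h : IsGraphGramian L (diagonal d) H) (f : V' → V) :
    IsGraphGramian (L.submatrix f f) (diagonal fun i => d (f i)) (H.submatrix id f) := by
  refine ⟨PosDef.diagonal fun i => (posDef_diagonal_iff.1 h.posDef) (f i), ?_⟩
  convert h.lyap.submatrix f using 1
  ext i j
  rw [Matrix.sub_apply, Matrix.add_apply, mul_diagonal, diagonal_mul]
  change _ = (Lᵀ * diagonal d + diagonal d * L - Hᵀ * H) (f i) (f j)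
  rw [Matrix.sub_apply, Matrix.add_apply, mul_diagonal, diagonal_mul]
  rfl

omit [DecidableEq ι] [Fintype π] in
/-- The Kronecker product of a Gramian of the graph and a storage matrix of the agents is a
generalized observability Gramian of the network. -/
lemma network_lyapunov {S : LTI ι μ μ} {K : Matrix ι ι ℝ} (hK : S.IsKYPSolution K)
    {L G : Matrix V V ℝ} {H : Matrix θ V ℝ} (hG : IsGraphGramian L G H) (F : Matrix V π ℝ)
    (H' : Matrix θ V ℝ) :
    (-((network S L F H').Aᵀ * (G ⊗ₖ K) + (G ⊗ₖ K) * (network S L F H').A +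
      (H ⊗ₖ S.C)ᵀ * (H ⊗ₖ S.C))).PosSemidef := by
  have hKB : K * S.B = S.Cᵀ := by
    rw [hK.2.2, transpose_mul, transpose_transpose, transpose_eq_of_posDef hK.1]
  have hCC : (S.Cᵀ * S.C).PosSemidef := by
    have := posSemidef_conjTranspose_mul_self S.C
    rwa [conjTranspose_eq_transpose_of_trivial] at this
  have h1 : (S.B * S.C)ᵀ * K = S.Cᵀ * S.C := by
    rw [transpose_mul, Matrix.mul_assoc, ← hK.2.2]
  have h2 : K * (S.B * S.C) = S.Cᵀ * S.C := by rw [← Matrix.mul_assoc, hKB]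
  have kt {a b c d : Type} (M : Matrix a b ℝ) (N : Matrix c d ℝ) : (M ⊗ₖ N)ᵀ = Mᵀ ⊗ₖ Nᵀ := rfl
  have kn {a b c d : Type} (M : Matrix a b ℝ) (N : Matrix c d ℝ) : M ⊗ₖ (-N) = -(M ⊗ₖ N) := by
    ext; simp
  have ks {a b c d : Type} (M M' : Matrix a b ℝ) (N : Matrix c d ℝ) :
      (M - M') ⊗ₖ N = M ⊗ₖ N - M' ⊗ₖ N := by
    ext; simp [sub_mul]
  -- By `K B = Cᵀ`, the coupling `L ⊗ B C` and the output term both carry the factor `Cᵀ C`.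
  have key : -((network S L F H').Aᵀ * (G ⊗ₖ K) + (G ⊗ₖ K) * (network S L F H').A +
      (H ⊗ₖ S.C)ᵀ * (H ⊗ₖ S.C)) =
      G ⊗ₖ (-(S.Aᵀ * K + K * S.A)) + (Lᵀ * G + G * L - Hᵀ * H) ⊗ₖ (S.Cᵀ * S.C) := by
    simp only [network, transpose_sub, Matrix.sub_mul, Matrix.mul_sub, kt, ← mul_kronecker_mul, h1,
      h2, transpose_one, Matrix.one_mul, Matrix.mul_one, kn, ks, add_kronecker, kronecker_add]
    abel
  rw [key]
  exact (hG.posDef.posSemidef.kronecker hK.2.1).add (hG.lyap.kronecker hCC)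

omit [Fintype π] in
lemma isUnit_pencil_network {S : LTI ι μ μ} {K : Matrix ι ι ℝ} (hK : S.IsKYPSolution K)
    {L G : Matrix V V ℝ} {H : Matrix θ V ℝ} (hG : IsGraphGramian L G H) (F : Matrix V π ℝ)
    (H' : Matrix θ V ℝ) {s : ℂ} (hs : 0 < s.re) : IsUnit ((network S L F H').pencil s) := by
  refine LTI.isUnit_pencil _ (hG.posDef.kronecker hK.1) ?_ hs
  simpa using network_lyapunov hK hG.zero_output F H'

omit [Fintype π] [Fintype θ] in
lemma transfer_network_eq_of_intertwining {S : LTI ι μ μ} {S' : LTI ι' μ μ}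
    {R : LTI V π θ} {R' : LTI V' π θ} (t : Matrix ι' ι ℝ) (g : Matrix V' V ℝ)
    (hSA : S'.A * t = t * S.A) (hSB : S'.B = t * S.B) (hSC : S'.C * t = S.C)
    (hRA : R'.A * g = g * R.A) (hRB : R'.B = g * R.B) (hRC : R'.C * g = R.C) {s : ℂ}
    (h' : IsUnit ((network S' R'.A R'.B R'.C).pencil s))
    (h : IsUnit ((network S R.A R.B R.C).pencil s)) :
    (network S' R'.A R'.B R'.C).transfer s = (network S R.A R.B R.C).transfer s := by
  refine transfer_eq_of_intertwining (g ⊗ₖ t) ?_ ?_ ?_ h' h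
  · simp only [network, Matrix.sub_mul, Matrix.mul_sub, ← mul_kronecker_mul, hSA, hRA,
      Matrix.mul_one, Matrix.one_mul]
    rw [Matrix.mul_assoc S'.B, hSC, hSB, Matrix.mul_assoc]
  · simp only [network, ← mul_kronecker_mul, hSB, hRB]
  · simp only [network, ← mul_kronecker_mul, hSC, hRC]

end Gramians

/-! ### Removing the average mode -/

section StablePart

/-- The inclusion of the states of the stable part of the graph. -/
def stableIncl (M : ℕ) : Matrix (Fin M ⊕ Unit) (Fin M) ℝ := fromRows 1 0

/-- The projection to the states of the stable part of the graph. -/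
def stableProj (M : ℕ) : Matrix (Fin M) (Fin M ⊕ Unit) ℝ := fromCols 1 0

lemma coupledN_mul_stableIncl {M p q : ℕ} (R : LTI (Fin M) (Fin p) (Fin q)) :
    coupledN R * stableIncl M = stableIncl M * R.A := by
  rw [coupledN, stableIncl, fromBlocks_mul_fromRows, fromRows_mul]
  simp

lemma stableProj_mul_coupledN {M p q : ℕ} (R : LTI (Fin M) (Fin p) (Fin q)) :
    stableProj M * coupledN R = R.A * stableProj M := by
  rw [coupledN, stableProj, fromCols_mul_fromBlocks, mul_fromCols]
  simp

/-- If the average module is uncontrollable or unobservable, the network has the transfer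
function of its stable part. -/
lemma transfer_network_coupled {M N p q m : ℕ} {ι V : Type} [Fintype ι] [DecidableEq ι]
    [Fintype V] [DecidableEq V] {S : LTI ι (Fin m) (Fin m)} {K : Matrix ι ι ℝ}
    (hK : S.IsKYPSolution K) {R : LTI (Fin M) (Fin p) (Fin q)} {g : Fin M → ℝ}
    {H' : Matrix (Fin q) (Fin M) ℝ} (hR : IsGraphGramian R.A (diagonal g) H')
    {P : Matrix (Fin M ⊕ Unit) V ℝ} {Q : Matrix V (Fin M ⊕ Unit) ℝ} (hPQ : P * Q = 1)
    (hQP : Q * P = 1) {F : Matrix (Fin N) (Fin p) ℝ} {H : Matrix (Fin q) (Fin N) ℝ}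
    (hHF : (H *ᵥ fun _ => 1) = 0 ∨ ((fun _ => 1) ᵥ* F) = 0) {s : ℂ} (hs : 0 < s.re) :
    (network S (Q * coupledN R * P) (Q * coupledF R F) (coupledH R H * P)).transfer s =
      (network S R.A R.B R.C).transfer s := by
  -- The average mode has zero dynamics in `𝒩`, so any positive weight, here `1`, extends the
  -- certificate once the output is set to zero.
  have hN : IsGraphGramian (coupledN R) (diagonal (Sum.elim g fun _ => 1))
      (0 : Matrix (Fin q) (Fin M ⊕ Unit) ℝ) := by
    refine ⟨PosDef.diagonal ?_, ?_⟩
    · rintro (i | i)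
      · exact posDef_diagonal_iff.1 hR.posDef i
      · exact one_pos
    · convert posSemidef_congr hR.zero_output.lyap
        (stableProj M) using 1
      ext (i | i) (j | j) <;>
        simp [coupledN, stableProj, mul_diagonal, diagonal_mul, transpose_fromCols, fromRows_mul, mul_fromCols]
  have h1 := isUnit_pencil_network hK (hN.congr hPQ hQP) (Q * coupledF R F) (coupledH R H * P) hs
  have h2 := isUnit_pencil_network hK hR R.B R.C hs
  rcases hHF with h | h
  -- Unobservable average: projecting it away intertwines the network with its stable part.
  · refine (transfer_network_eq_of_intertwining
      (R' := R) (R := ⟨Q * coupledN R * P, Q * coupledF R F, coupledH R H * P⟩)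
      1 (stableProj M * P) ?_ ?_ ?_ ?_ ?_ ?_ h2 h1).symm
    · simp
    · simp
    · simp
    · rw [← Matrix.mul_assoc, ← stableProj_mul_coupledN]
      simp only [Matrix.mul_assoc]
      rw [← Matrix.mul_assoc P, hPQ, Matrix.one_mul]
    · change _ = stableProj M * P * (Q * coupledF R F)
      rw [Matrix.mul_assoc, ← Matrix.mul_assoc P, hPQ, Matrix.one_mul, coupledF,
        stableProj, fromCols_mul_fromRows]
      simp
    · change _ = coupledH R H * P
      rw [← Matrix.mul_assoc, stableProj, mul_fromCols, coupledH, h]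
      congr 1
      ext i (j | j) <;> simp
  -- Uncontrollable average: the inclusion of the stable states does so in the other direction.
  · refine transfer_network_eq_of_intertwining
      (R := R) (R' := ⟨Q * coupledN R * P, Q * coupledF R F, coupledH R H * P⟩)
      1 (Q * stableIncl M) ?_ ?_ ?_ ?_ ?_ ?_ h1 h2
    · simp
    · simp
    · simp
    · rw [Matrix.mul_assoc Q _ R.A, ← coupledN_mul_stableIncl]
      simp only [Matrix.mul_assoc]
      rw [← Matrix.mul_assoc P, hPQ, Matrix.one_mul]
    · change Q * coupledF R F = _
      rw [Matrix.mul_assoc, stableIncl, fromRows_mul, coupledF, h]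
      congr 1
      ext (i | i) j <;> simp
    · change coupledH R H * P * (Q * stableIncl M) = _
      rw [Matrix.mul_assoc, ← Matrix.mul_assoc P, hPQ, Matrix.one_mul, coupledH,
        stableIncl, fromCols_mul_fromRows]
      simp

end StablePart

/-! ### Consequences of balancing -/

section Balancing
variable {M : ℕ}

lemma IsBalancing.pos {P Q T : Matrix (Fin M) (Fin M) ℝ} {σ : Fin M → ℝ}
    (h : IsBalancing P Q T σ) (hP : P.PosDef) (i : Fin M) : 0 < σ i := by
  have hd := (Matrix.isUnit_iff_isUnit_det _).1 h.nonsing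
  have h1 : T⁻¹ᵀ * Tᵀ = 1 := by rw [← transpose_mul, Matrix.mul_nonsing_inv _ hd, transpose_one]
  have := posDef_congr_of_inverse hP h1
  rw [transpose_transpose, h.left] at this
  exact posDef_diagonal_iff.1 this i

/-- This is the inverse of `T P Tᵀ = diag(σ)`, the form needed for certificates stated through `X⁻¹`
and `Kmax`. -/
lemma IsBalancing.inv_left {P Q T : Matrix (Fin M) (Fin M) ℝ} {σ : Fin M → ℝ}
    (h : IsBalancing P Q T σ) (hP : P.PosDef) : (T⁻¹)ᵀ * P⁻¹ * T⁻¹ = diagonal σ⁻¹ := by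
  have h0 : diagonal σ * diagonal σ⁻¹ = 1 := by
    rw [diagonal_mul_diagonal, ← diagonal_one]
    congr 1
    ext i
    simp [(h.pos hP i).ne']
  rw [← Matrix.inv_eq_right_inv h0, ← h.left, Matrix.mul_inv_rev, Matrix.mul_inv_rev,
    transpose_nonsing_inv, Matrix.mul_assoc]

end Balancing

end NetworkBT

namespace NetworkBT

/-! ### The balanced network and its restriction -/

section BalancedNetwork
variable {V ι μ π θ : Type} [Fintype V] [DecidableEq V] [Fintype ι] [DecidableEq ι] [Fintype μ]
  [Fintype π] [Fintype θ]

/-- Both inequalities are instances of `network_lyapunov`. For controllability, `C = Bᵀ diag(τ)⁻¹`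
identifies `Fᵀ diag(σ)⁻¹ ⊗ C` with the network input matrix, transposed, times the inverse weight.
-/
lemma isBalancedBy_network {S : LTI ι μ μ} {τ : ι → ℝ} (hτ : S.IsKYPSolution (diagonal τ))
    (hτ' : S.IsKYPSolution (diagonal τ⁻¹)) {L : Matrix V V ℝ} {F : Matrix V π ℝ}
    {H : Matrix θ V ℝ} {σ : V → ℝ} (hσ : IsGraphGramian L (diagonal σ) H)
    (hσ' : IsGraphGramian L (diagonal σ⁻¹) (Fᵀ * diagonal σ⁻¹)) :
    (network S L F H).IsBalancedBy fun i => σ i.1 * τ i.2 := by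
  refine ⟨fun i => mul_pos (posDef_diagonal_iff.1 hσ.posDef _) (posDef_diagonal_iff.1 hτ.1 _),
    ?_, ?_⟩
  · have := network_lyapunov hτ hσ F H
    rwa [diagonal_kronecker_diagonal] at this
  · have := network_lyapunov hτ' hσ' F (Fᵀ * diagonal σ⁻¹)
    have hd : (diagonal σ⁻¹ : Matrix V V ℝ) ⊗ₖ (diagonal τ⁻¹ : Matrix ι ι ℝ) =
        diagonal (fun i : V × ι => σ i.1 * τ i.2)⁻¹ := by
      rw [diagonal_kronecker_diagonal]
      congr 1
      ext i
      simp [mul_comm]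
    have hC : (Fᵀ * diagonal σ⁻¹) ⊗ₖ S.C =
        (network S L F H).Bᵀ * diagonal (fun i : V × ι => σ i.1 * τ i.2)⁻¹ := by
      rw [← hd, hτ'.2.2, mul_kronecker_mul]
      rfl
    rw [hd, hC] at this
    exact this

omit [Fintype V] [Fintype ι] [DecidableEq ι] [Fintype π] [Fintype θ] in
-- The product `B C` sums over ports, which are not truncated; injectivity of `f` keeps the identity
-- factor an identity.
lemma network_restrict {V' ι' : Type} [DecidableEq V'] (S : LTI ι μ μ)
    (R : LTI V π θ) {f : V' → V} {g : ι' → ι} (hf : f.Injective) :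
    (network S R.A R.B R.C).restrict (Prod.map f g) =
      network (S.restrict g) (R.restrict f).A (R.restrict f).B (R.restrict f).C := by
  have h1 : ((1 : Matrix V V ℝ) ⊗ₖ S.A).submatrix (Prod.map f g) (Prod.map f g) =
      (1 : Matrix V' V' ℝ) ⊗ₖ S.A.submatrix g g := by
    ext i j
    simp [one_apply, hf.eq_iff]
  simp only [LTI.restrict, network, LTI.mk.injEq]
  refine ⟨?_, rfl, rfl⟩
  rw [← h1]
  rfl

end BalancedNetwork

/-! ### The discarded pairs and the bound for the stable part -/

lemma errorBound_eq {N n k r : ℕ} (hk : k - 1 ≤ N - 1) (hr : r ≤ n) (σ : Fin (N - 1) → ℝ)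
    (τ : Fin n → ℝ) :
    errorBound k r σ τ = 2 * ∑ i ∈ (Finset.univ.image
      (Prod.map (Fin.castLE hk) (Fin.castLE hr)))ᶜ, σ i.1 * τ i.2 := by
  have hmem : ∀ i : Fin (N - 1) × Fin n,
      i ∈ (Finset.univ.image (Prod.map (Fin.castLE hk) (Fin.castLE hr)))ᶜ ↔
        ¬ (i.1.val < k - 1 ∧ i.2.val < r) := by
    rintro ⟨i, j⟩
    rw [Finset.mem_compl, not_iff_not, Finset.mem_image]
    constructor
    · rintro ⟨⟨a, b⟩, -, h⟩
      cases h
      exact ⟨a.2, b.2⟩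
    · rintro ⟨hi, hj⟩
      exact ⟨(⟨i, hi⟩, ⟨j, hj⟩), Finset.mem_univ _, rfl⟩
  rw [errorBound, ← mul_add]
  congr 1
  -- A pair is discarded if its graph index is, or else if only its agent index is; these are the
  -- two sums of `γ`.
  rw [← Finset.sum_product', ← Finset.sum_product', ← Finset.sum_union]
  · refine Finset.sum_congr ?_ fun _ _ => rfl
    ext i
    rw [hmem]
    simp only [Finset.mem_union, Finset.mem_product, Finset.mem_filter, Finset.mem_univ, true_and,
      and_true]
    omega
  · rw [Finset.disjoint_left]
    intro i
    simp only [Finset.mem_product, Finset.mem_filter, Finset.mem_univ, true_and, and_true]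
    omega

lemma LTI.changeBasis_mul {n : ℕ} {υ ο : Type} (S : LTI (Fin n) υ ο)
    {T : Matrix (Fin n) (Fin n) ℝ} (hT : IsUnit T) :
    (S.changeBasis T).A * T = T * S.A ∧ (S.changeBasis T).B = T * S.B ∧
      (S.changeBasis T).C * T = S.C := by
  have hd := (Matrix.isUnit_iff_isUnit_det _).1 hT
  exact ⟨Matrix.nonsing_inv_mul_cancel_right _ _ hd, rfl,
    Matrix.nonsing_inv_mul_cancel_right _ _ hd⟩

open scoped Matrix.Norms.L2Operator in
/-- The error bound for the stable part of the network, at a point of the open right half-plane. -/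
lemma norm_transfer_network_sub_truncate_le {M n m p q k r : ℕ} (hk : k ≤ M) (hr : r ≤ n)
    {S : LTI (Fin n) (Fin m) (Fin m)} {Kmin Kmax : Matrix (Fin n) (Fin n) ℝ}
    (hKmin : S.IsKYPSolution Kmin) (hKmax : S.IsKYPSolution Kmax)
    {R : LTI (Fin M) (Fin p) (Fin q)} {X Y : Matrix (Fin M) (Fin M) ℝ} (hX : X.PosDef)
    (hX' : IsGraphGramian R.A X⁻¹ (R.Bᵀ * X⁻¹)) (hY : IsGraphGramian R.A Y R.C)
    {TG : Matrix (Fin M) (Fin M) ℝ} {σ : Fin M → ℝ} (hTG : IsBalancing X Y TG σ)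
    {TD : Matrix (Fin n) (Fin n) ℝ} {τ : Fin n → ℝ} (hTD : IsBalancing Kmax⁻¹ Kmin TD τ)
    {s : ℂ} (hs : 0 < s.re) :
    IsGraphGramian (R.truncate TG hk).A (diagonal fun i => σ (Fin.castLE hk i))
      (R.truncate TG hk).C ∧
    (S.truncate TD hr).IsKYPSolution (diagonal fun i => τ (Fin.castLE hr i)) ∧
    ‖(network S R.A R.B R.C).transfer s -
      (network (S.truncate TD hr) (R.truncate TG hk).A (R.truncate TG hk).B
        (R.truncate TG hk).C).transfer s‖ ≤
      2 * ∑ i ∈ (Finset.univ.image (Prod.map (Fin.castLE hk) (Fin.castLE hr)))ᶜ,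
        σ i.1 * τ i.2 := by
  have dG := (Matrix.isUnit_iff_isUnit_det _).1 hTG.nonsing
  have dD := (Matrix.isUnit_iff_isUnit_det _).1 hTD.nonsing
  have hτ : (S.changeBasis TD).IsKYPSolution (diagonal τ) := by
    rw [← hTD.right]
    exact hKmin.changeBasis hTD.nonsing
  -- The first matrix of the balanced pair is `Kmax⁻¹`, so the inverted relation concerns `Kmax`
  -- itself.
  have hτ' : (S.changeBasis TD).IsKYPSolution (diagonal τ⁻¹) := by
    rw [← hTD.inv_left hKmax.1.inv,
      Matrix.nonsing_inv_nonsing_inv _ ((Matrix.isUnit_iff_isUnit_det _).1 hKmax.1.isUnit)]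
    exact hKmax.changeBasis hTD.nonsing
  have hσ : IsGraphGramian (R.changeBasis TG).A (diagonal σ) (R.changeBasis TG).C := by
    rw [← hTG.right]
    exact hY.congr (Matrix.nonsing_inv_mul _ dG) (Matrix.mul_nonsing_inv _ dG)
  have hσ' : IsGraphGramian (R.changeBasis TG).A (diagonal σ⁻¹)
      ((R.changeBasis TG).Bᵀ * diagonal σ⁻¹) := by
    have h1 : (R.changeBasis TG).Bᵀ * diagonal σ⁻¹ = R.Bᵀ * X⁻¹ * TG⁻¹ := by
      have h3 : TGᵀ * (TG⁻¹)ᵀ = 1 := by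
        rw [← transpose_mul, Matrix.nonsing_inv_mul _ dG, transpose_one]
      rw [← hTG.inv_left hX, LTI.changeBasis, transpose_mul, Matrix.mul_assoc (TG⁻¹)ᵀ,
        Matrix.mul_assoc R.Bᵀ TGᵀ, ← Matrix.mul_assoc TGᵀ (TG⁻¹)ᵀ, h3, Matrix.one_mul,
        Matrix.mul_assoc]
    rw [h1, ← hTG.inv_left hX]
    exact hX'.congr (Matrix.nonsing_inv_mul _ dG) (Matrix.mul_nonsing_inv _ dG)
  have hG := hσ.submatrix_diagonal (Fin.castLE hk)
  have hK := hτ.restrict_diagonal (Fin.castLE hr)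
  refine ⟨hG, hK, ?_⟩
  have hbal := isBalancedBy_network hτ hτ' (F := (R.changeBasis TG).B) hσ hσ'
  obtain ⟨hSA, hSB, hSC⟩ := S.changeBasis_mul hTD.nonsing
  obtain ⟨hRA, hRB, hRC⟩ := R.changeBasis_mul hTG.nonsing
  have h1 := transfer_network_eq_of_intertwining TD TG hSA hSB hSC hRA hRB hRC
    (isUnit_pencil_network hτ hσ _ _ hs) (isUnit_pencil_network hKmin hY _ _ hs)
  have hinj : (Prod.map (Fin.castLE hk) (Fin.castLE hr)).Injective :=
    (Fin.castLE_injective hk).prodMap (Fin.castLE_injective hr)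
  have hres := network_restrict (S.changeBasis TD) (R.changeBasis TG)
    (g := Fin.castLE hr) (Fin.castLE_injective hk)
  have h2 := LTI.transfer_mask_image (s := s) (network (S.changeBasis TD) (R.changeBasis TG).A
    (R.changeBasis TG).B (R.changeBasis TG).C) hinj
    (LTI.isUnit_pencil_mask _ hbal.pos hbal.lyapunov _ hs)
    (by rw [hres]; exact isUnit_pencil_network hK hG _ _ hs)
  have h3 := hbal.norm_transfer_sub_mask_le
    (Finset.univ.image (Prod.map (Fin.castLE hk) (Fin.castLE hr))) hs
  rw [h2, hres, h1] at h3
  exact h3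

lemma hInfDist_congr {ι κ ι' κ' υ ο : Type} [Fintype ι] [DecidableEq ι] [Fintype κ]
    [DecidableEq κ] [Fintype ι'] [DecidableEq ι'] [Fintype κ'] [DecidableEq κ'] [Fintype υ]
    [Fintype ο] [DecidableEq υ] {S₁ : LTI ι υ ο} {S₂ : LTI κ υ ο} {S₁' : LTI ι' υ ο}
    {S₂' : LTI κ' υ ο} (h₁ : ∀ s : ℂ, 0 < s.re → S₁.transfer s = S₁'.transfer s)
    (h₂ : ∀ s : ℂ, 0 < s.re → S₂.transfer s = S₂'.transfer s) :
    hInfDist S₁ S₂ = hInfDist S₁' S₂' := by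
  refine iSup_congr fun s => iSup_congr fun hs => ?_
  simp only [h₁ s hs, h₂ s hs]

end NetworkBT

theorem mainTheorem4
    {N n m p q k r : ℕ} (hk : 1 ≤ k) (hkN : k ≤ N) (hrn : r ≤ n)
    -- the agents
    (S : LTI (Fin n) (Fin m) (Fin m)) (_hmin : S.IsMinimal) (_hpass : S.IsPassive)
    -- the network
    (w : Fin N → Fin N → ℝ) (hw : IsUndirectedWeight w) (hconn : (weightGraph w).Connected)
    (F : Matrix (Fin N) (Fin p) ℝ) (H : Matrix (Fin q) (Fin N) ℝ)
    -- the spectral decomposition of the Laplacian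
    (T₁ : Matrix (Fin N) (Fin (N - 1)) ℝ) (lam : Fin (N - 1) → ℝ)
    (hT : IsSpectralDecomp (laplacian w) T₁ lam)
    -- the Gramians of the network and the extremal storage matrices of the agents
    (X Y : Matrix (Fin (N - 1)) (Fin (N - 1)) ℝ)
    (hXY : AreNetworkGramians lam (T₁ᵀ * F) (H * T₁) X Y)
    (Kmin Kmax : Matrix (Fin n) (Fin n) ℝ)
    (hKmin : S.IsMinKYPSolution Kmin) (hKmax : S.IsMaxKYPSolution Kmax)
    -- the balancing transformations
    (TG : Matrix (Fin (N - 1)) (Fin (N - 1)) ℝ) (σ : Fin (N - 1) → ℝ)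
    (hTG : IsBalancing X Y TG σ)
    (TD : Matrix (Fin n) (Fin n) ℝ) (τ : Fin n → ℝ)
    (hTD : IsBalancing Kmax⁻¹ Kmin TD τ)
    -- the reduced agents and the reduced stable network triple
    (Sr : LTI (Fin r) (Fin m) (Fin m)) (hSr : Sr = S.truncate TD hrn)
    (R : LTI (Fin (k - 1)) (Fin p) (Fin q))
    (hR : R = (LTI.mk (diagonal lam) (T₁ᵀ * F) (H * T₁)).truncate TG
      (Nat.sub_le_sub_right hkN 1))
    -- the realization of the reduced model as a network, by the nonsingular matrix `Tn`
    (Tn : Matrix (Fin (k - 1) ⊕ Unit) (Fin k) ℝ) (TnInv : Matrix (Fin k) (Fin (k - 1) ⊕ Unit) ℝ)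
    (hTn : Tn * TnInv = 1) (hTn' : TnInv * Tn = 1)
    (hL : IsConnectedLaplacian (TnInv * coupledN R * Tn))
    -- the average module is unobservable or uncontrollable
    (hHF : (H *ᵥ fun _ => 1) = 0 ∨ ((fun _ => 1) ᵥ* F) = 0) :
    hInfDist (network S (laplacian w) F H)
        (network Sr (TnInv * coupledN R * Tn) (TnInv * coupledF R F) (coupledH R H * Tn)) =
      hInfDist (network S (diagonal lam) (T₁ᵀ * F) (H * T₁)) (network Sr R.A R.B R.C) ∧
    hInfDist (network S (diagonal lam) (T₁ᵀ * F) (H * T₁)) (network Sr R.A R.B R.C) ≤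
      ENNReal.ofReal (errorBound k r σ τ) := by
  subst hSr hR
  set R₀ : LTI (Fin (N - 1)) (Fin p) (Fin q) := ⟨diagonal lam, T₁ᵀ * F, H * T₁⟩ with hR₀
  have hk' : k - 1 ≤ N - 1 := Nat.sub_le_sub_right hkN 1
  -- Multiplying the Lyapunov equation for `X` by `X⁻¹` on both sides makes the required
  -- semidefinite matrix zero.
  have hX' : IsGraphGramian R₀.A X⁻¹ (R₀.Bᵀ * X⁻¹) := by
    refine ⟨hXY.posDef_X.inv, ?_⟩
    have hd := (Matrix.isUnit_iff_isUnit_det _).1 hXY.posDef_X.isUnit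
    have h0 : R₀.B * R₀.Bᵀ = diagonal lam * X + X * diagonal lam := by
      have := hXY.lyap_X
      rw [← sub_eq_zero, ← this]
      abel
    have h1 : (R₀.Bᵀ * X⁻¹)ᵀ * (R₀.Bᵀ * X⁻¹) = X⁻¹ * (R₀.B * R₀.Bᵀ) * X⁻¹ := by
      rw [transpose_mul, transpose_transpose, transpose_eq_of_posDef hXY.posDef_X.inv]
      simp only [Matrix.mul_assoc]
    have h2 : R₀.Aᵀ * X⁻¹ + X⁻¹ * R₀.A - (R₀.Bᵀ * X⁻¹)ᵀ * (R₀.Bᵀ * X⁻¹) = 0 := by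
      rw [h1, h0, Matrix.mul_add, Matrix.add_mul, Matrix.mul_assoc X⁻¹ (_ * X),
        Matrix.mul_nonsing_inv_cancel_right _ _ hd, Matrix.nonsing_inv_mul_cancel_left _ _ hd]
      simp only [hR₀, diagonal_transpose]
      abel
    rw [h2]
    exact PosSemidef.zero
  have hY : IsGraphGramian R₀.A Y R₀.C := by
    refine ⟨hXY.posDef_Y, ?_⟩
    convert hXY.lyap_Y using 1
    simp only [hR₀, diagonal_transpose]
    abel
  have bound (s : ℂ) (hs : 0 < s.re) := norm_transfer_network_sub_truncate_le hk' hrn hKmin.1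
    hKmax.1 hXY.posDef_X hX' hY hTG hTD hs
  constructor
  · set T := fromCols T₁ (replicateCol Unit fun _ => 1 / √(N : ℝ)) with hTdef
    have hcF : coupledF R₀ F = Tᵀ * F := by
      rw [hTdef, transpose_fromCols, fromRows_mul, coupledF]
      congr 1
      ext i j
      simp [vecMul, dotProduct, mul_apply, Finset.mul_sum]
    have hcH : coupledH R₀ H = H * T := by
      rw [hTdef, mul_fromCols, coupledH]
      congr 1
      ext i j
      simp [mulVec, dotProduct, mul_apply, Finset.sum_mul, mul_comm]
    -- The original network has the same coupled form as the reduced one, with the orthogonal `T` in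
    -- place of `TnInv`.
    have hfull : network S (laplacian w) F H =
        network S (T * coupledN R₀ * Tᵀ) (T * coupledF R₀ F) (coupledH R₀ H * Tᵀ) := by
      have hTT : T * Tᵀ = 1 := hT.orth_right
      rw [hcF, hcH, ← Matrix.mul_assoc, hTT, Matrix.one_mul, Matrix.mul_assoc H, hTT,
        Matrix.mul_one, hT.decomp]
      rfl
    -- `transfer_network_coupled` asks for a diagonal certificate; as `Λ ≥ 0`, the identity serves,
    -- with zero output.
    have hlam : IsGraphGramian R₀.A (diagonal fun _ => 1)
        (0 : Matrix (Fin q) (Fin (N - 1)) ℝ) := by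
      refine ⟨PosDef.diagonal fun _ => one_pos, ?_⟩
      simp only [hR₀, diagonal_transpose, diagonal_one, Matrix.mul_one, Matrix.one_mul,
        Matrix.mul_zero, sub_zero, diagonal_add]
      exact PosSemidef.diagonal fun i => add_nonneg (hT.pos i).le (hT.pos i).le
    refine hInfDist_congr (fun s hs => ?_) fun s hs => ?_
    · rw [hfull]
      exact transfer_network_coupled hKmin.1 hlam hT.orth_left hT.orth_right hHF hs
    · exact transfer_network_coupled (bound s hs).2.1 (bound s hs).1 hTn hTn' hHF hs
  · refine iSup₂_le fun s hs => ENNReal.ofReal_le_ofReal ?_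
    rw [errorBound_eq hk' hrn]
    exact (bound s hs).2.2
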